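/- \textbf{Theorem.} A finite chain ring is a finite commutative ring with $1$ which is a local principal ideal ring. For every integer $n\ge 1$ there exists a constant $C(n)>0$, depending only on $n$, such that the following holds. Let $R$ be a finite chain ring with maximal ideal $\mathfrak m$, let $q=|R/\mathfrak m|$ be the size of its residue field, and let $r$ be the integer with $|R|=q^r$. If $A\subset \mathrm{M}_n(R)$ is a set of $n\times n$ matrices over $R$ satisfying $$|A|\ge C(n)\,q^{rn^2-1},$$ then $$\max\bigl(|A+A|,\,|AA|\bigr)\ \ge\ C(n)^{-1}\min\left(\frac{|A|^2}{q^{\,rn^2-\frac{n+1}{4}}},\ q^{\frac{rn^2}{3}}|A|^{\frac23}\right),$$ where $A+A=\{a+b: a,b\in A\}$ and $AA=\{ab: a,b\in A\}$. -/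

import Mathlib

open scoped Pointwise

/-!
Let `M = M_n(R)` and let `k`, with `q` elements, be the residue field of `R`.

At most `n * |M| / q` matrices are singular (`ncard_not_isUnit_le`), so the lower bound on `|A|` lets
one replace `A` by its set of units. For a set `A` of units, every triple `(a, c, b)` in `A` gives a
solution `(a⁻¹, a * c, b, c + b)` of `u * x + b = y` with `u ∈ A⁻¹`, `x ∈ A * A`, `b ∈ A` and
`y ∈ A + A`, so there are at least `|A| ^ 3` solutions. Expanding the condition `u * x + b = y` in
additive characters `ψ` of `M` (`card_mul_add_eq_le`), the trivial character contributes the expected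
number `|A| ^ 2 * |A * A| * |A + A| / |M|`, and by Cauchy–Schwarz and Parseval the others contribute
at most `√(κ * |M| * |A| ^ 2 * |A * A| * |A + A|)`, where `κ` bounds the number of `w` with
`w * M ⊆ ker ψ` for nontrivial `ψ`.

These `w` form a proper right ideal of `M`, and `card_residueField_pow_le_index` shows that such an
ideal has index at least `q ^ n`; hence `κ = |M| / q ^ n` is admissible. Comparing the two terms with
`|A| ^ 3` yields
`max (|A + A|, |A * A|) ≫ min (|A| ^ 2 / (|M| * q ^ (-n / 2)), |M| ^ (1 / 2) * |A| ^ (1 / 2))`,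
which implies the claim because `(n + 1) / 4 ≤ n / 2` and `|A| ≤ |M|`.
-/

/-! ### Additive characters and counting solutions of `u * x + b = y` -/

section Fourier

open Finset ComplexConjugate

/-- Expanding a squared character sum, in a family of additive characters. -/
lemma sum_norm_sq_addChar_sum {G ι : Type*} [AddCommGroup G] [Finite G]
    (I : Finset ι) (φ : ι → AddChar G ℂ) (S : Finset G) :
    ((∑ i ∈ I, ‖∑ s ∈ S, φ i s‖ ^ 2 : ℝ) : ℂ) =
      ∑ s ∈ S, ∑ t ∈ S, ∑ i ∈ I, φ i (s - t) := by
  have h (i : ι) : ((‖∑ s ∈ S, φ i s‖ ^ 2 : ℝ) : ℂ) = ∑ s ∈ S, ∑ t ∈ S, φ i (s - t) := by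
    push_cast
    rw [← Complex.mul_conj', map_sum, sum_mul_sum]
    refine sum_congr rfl fun s _ ↦ sum_congr rfl fun t _ ↦ ?_
    rw [sub_eq_add_neg, AddChar.map_add_eq_mul, AddChar.map_neg_eq_conj]
  push_cast at h ⊢
  simp_rw [h]
  rw [sum_comm]
  exact sum_congr rfl fun s _ ↦ sum_comm

/-- Parseval's identity for the indicator function of `S`. -/
lemma sum_norm_sq_addChar_sum_eq_card_mul_card {G : Type*} [AddCommGroup G] [Fintype G]
    [DecidableEq G] (S : Finset G) :
    ∑ ψ : AddChar G ℂ, ‖∑ s ∈ S, ψ s‖ ^ 2 = Fintype.card G * #S := by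
  have h := sum_norm_sq_addChar_sum (univ : Finset (AddChar G ℂ)) id S
  simp only [id, AddChar.sum_apply_eq_ite, sub_eq_zero] at h
  apply Complex.ofReal_injective
  rw [h]
  simp [mul_comm]

/-- A bilinear character sum over a finite ring is small as soon as few `w` satisfy
`w * M ⊆ ker ψ`. -/
lemma norm_sq_sum_sum_addChar_mul_le {M : Type*} [Ring M] [Fintype M] (ψ : AddChar M ℂ)
    (U X : Finset M) (κ : ℝ) (hκ : (Nat.card {w : M // ∀ x, ψ (w * x) = 1} : ℝ) ≤ κ) :
    ‖∑ u ∈ U, ∑ x ∈ X, ψ (u * x)‖ ^ 2 ≤ κ * Fintype.card M * #U * #X := by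
  classical
  -- By Cauchy–Schwarz the variable `x` may be summed over the whole ring.
  have hCS : ‖∑ u ∈ U, ∑ x ∈ X, ψ (u * x)‖ ^ 2 ≤
      #X * ∑ x : M, ‖∑ u ∈ U, ψ (u * x)‖ ^ 2 := by
    rw [sum_comm]
    calc _ ≤ (∑ x ∈ X, ‖∑ u ∈ U, ψ (u * x)‖) ^ 2 := by gcongr; exact norm_sum_le _ _
      _ ≤ #X * ∑ x ∈ X, ‖∑ u ∈ U, ψ (u * x)‖ ^ 2 := sq_sum_le_card_mul_sum_sq
      _ ≤ _ := by
        gcongr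
        exact subset_univ _
  have hL (w : M) : ∑ x : M, ψ (w * x) =
      if ∀ x, ψ (w * x) = 1 then (Fintype.card M : ℂ) else 0 := by
    have := AddChar.sum_eq_ite (ψ.compAddMonoidHom (AddMonoidHom.mulLeft w))
    simpa [AddChar.ext_iff] using this
  have hE := sum_norm_sq_addChar_sum (univ : Finset M)
    (fun x ↦ ψ.compAddMonoidHom (AddMonoidHom.mulRight x)) U
  simp only [AddChar.compAddMonoidHom_apply, AddMonoidHom.mulRight_apply, hL] at hE
  have hE' : ∑ x : M, ‖∑ u ∈ U, ψ (u * x)‖ ^ 2 =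
      ∑ s ∈ U, ∑ t ∈ U, if ∀ x, ψ ((s - t) * x) = 1 then (Fintype.card M : ℝ) else 0 := by
    apply Complex.ofReal_injective
    rw [hE]
    push_cast
    simp only [apply_ite Complex.ofReal, Complex.ofReal_natCast, Complex.ofReal_zero]
  have hK (s : M) : (∑ t ∈ U, if ∀ x, ψ ((s - t) * x) = 1 then (Fintype.card M : ℝ) else 0) ≤
      κ * Fintype.card M := by
    calc _ ≤ ∑ t : M, if ∀ x, ψ ((s - t) * x) = 1 then (Fintype.card M : ℝ) else 0 :=
          sum_le_sum_of_subset_of_nonneg (subset_univ _) fun _ _ _ ↦ by positivity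
      _ = ∑ w : M, if ∀ x, ψ (w * x) = 1 then (Fintype.card M : ℝ) else 0 :=
          (Equiv.subLeft s).sum_comp fun w ↦
            if ∀ x, ψ (w * x) = 1 then (Fintype.card M : ℝ) else 0
      _ = (Nat.card {w : M // ∀ x, ψ (w * x) = 1} : ℝ) * Fintype.card M := by
          rw [← sum_filter, sum_const, nsmul_eq_mul, Nat.card_eq_fintype_card,
            Fintype.card_subtype]
      _ ≤ _ := by gcongr
  calc _ ≤ #X * ∑ x : M, ‖∑ u ∈ U, ψ (u * x)‖ ^ 2 := hCS
    _ ≤ #X * ∑ s ∈ U, κ * Fintype.card M := by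
      rw [hE']
      gcongr with s _
      exact hK s
    _ = _ := by
      rw [sum_const, nsmul_eq_mul]
      ring

/-- The number of solutions of `u * x + b = y` with variables in given subsets of a finite ring
exceeds its expected value by at most a square root error term. -/
lemma card_mul_add_eq_le {M : Type*} [Ring M] [Fintype M] [DecidableEq M]
    (U X B Y : Finset M) (κ : ℝ)
    (hκ : ∀ ψ : AddChar M ℂ, ψ ≠ 0 → (Nat.card {w : M // ∀ x, ψ (w * x) = 1} : ℝ) ≤ κ) :
    (#{p ∈ U ×ˢ X ×ˢ B ×ˢ Y | p.1 * p.2.1 + p.2.2.1 = p.2.2.2} : ℝ) ≤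
      #U * #X * #B * #Y / Fintype.card M + √(κ * Fintype.card M * #U * #X * #B * #Y) := by
  set m : ℝ := (Fintype.card M : ℝ) with hm
  have hm0 : 0 < m := by rw [hm]; exact_mod_cast Fintype.card_pos
  set T := #{p ∈ U ×ˢ X ×ˢ B ×ˢ Y | p.1 * p.2.1 + p.2.2.1 = p.2.2.2} with hT
  let F (ψ : AddChar M ℂ) : ℂ :=
    (∑ u ∈ U, ∑ x ∈ X, ψ (u * x)) * (∑ b ∈ B, ψ b) * conj (∑ y ∈ Y, ψ y)
  have hF : (m * T : ℂ) = ∑ ψ : AddChar M ℂ, F ψ := by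
    have h1 (ψ : AddChar M ℂ) : F ψ =
        ∑ p ∈ U ×ˢ X ×ˢ B ×ˢ Y, ψ (p.1 * p.2.1 + p.2.2.1 - p.2.2.2) := by
      simp only [F, sum_product, sub_eq_add_neg, AddChar.map_add_eq_mul,
        AddChar.map_neg_eq_conj, ← mul_sum, ← sum_mul, ← map_sum]
    simp_rw [h1]
    rw [sum_comm]
    simp_rw [AddChar.sum_apply_eq_ite, sub_eq_zero]
    rw [← sum_filter, sum_const, nsmul_eq_mul, mul_comm, hm, hT]
    push_cast
    rfl
  have hF0 : ‖F 0‖ = #U * #X * #B * #Y := by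
    simp [F]
  set E : ℝ := √(κ * m * #U * #X) with hE
  have hFψ (ψ : AddChar M ℂ) (hψ : ψ ≠ 0) :
      ‖F ψ‖ ≤ E * (‖∑ b ∈ B, ψ b‖ * ‖∑ y ∈ Y, ψ y‖) := by
    have h1 := norm_sq_sum_sum_addChar_mul_le ψ U X κ (hκ ψ hψ)
    have h2 : ‖∑ u ∈ U, ∑ x ∈ X, ψ (u * x)‖ ≤ E := Real.le_sqrt_of_sq_le h1
    simp only [F, norm_mul, RCLike.norm_conj]
    rw [mul_assoc]
    gcongr
  have hsum : m * T ≤ #U * #X * #B * #Y + E * (√(m * #B) * √(m * #Y)) := by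
    calc m * T = ‖(m * T : ℂ)‖ := by
          rw [norm_mul, Complex.norm_natCast, Complex.norm_real, Real.norm_of_nonneg hm0.le]
      _ ≤ ∑ ψ : AddChar M ℂ, ‖F ψ‖ := by rw [hF]; exact norm_sum_le _ _
      _ = ‖F 0‖ + ∑ ψ ∈ univ.erase (0 : AddChar M ℂ), ‖F ψ‖ :=
          (add_sum_erase _ _ (mem_univ _)).symm
      _ ≤ #U * #X * #B * #Y + ∑ ψ ∈ univ.erase (0 : AddChar M ℂ),
            E * (‖∑ b ∈ B, ψ b‖ * ‖∑ y ∈ Y, ψ y‖) := by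
          rw [hF0]
          gcongr with ψ hψ
          exact hFψ ψ (ne_of_mem_erase hψ)
      _ ≤ #U * #X * #B * #Y + ∑ ψ : AddChar M ℂ,
            E * (‖∑ b ∈ B, ψ b‖ * ‖∑ y ∈ Y, ψ y‖) := by
          gcongr
          exact subset_univ _
      _ ≤ _ := by
          rw [← mul_sum]
          gcongr
          rw [← sum_norm_sq_addChar_sum_eq_card_mul_card B,
            ← sum_norm_sq_addChar_sum_eq_card_mul_card Y]
          exact Real.sum_mul_le_sqrt_mul_sqrt _ _ _
  have hsq : E * (√(m * #B) * √(m * #Y)) = m * √(κ * m * #U * #X * #B * #Y) := by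
    rw [← Real.sqrt_mul (by positivity), show m * #B * (m * #Y) = m ^ 2 * (#B * #Y) by ring,
      Real.sqrt_mul (by positivity), Real.sqrt_sq hm0.le, hE,
      show κ * m * #U * #X * #B * #Y = κ * m * #U * #X * (#B * #Y) by ring,
      Real.sqrt_mul' (κ * m * #U * #X) (y := #B * #Y) (by positivity)]
    ring
  rw [hsq] at hsum
  rw [div_add' _ _ _ hm0.ne', le_div_iff₀ hm0]
  linarith

/-- The counting argument behind the sum-product bound: for a set `A` of units, every triple
`(a, c, b)` of elements of `A` gives the solution `(a⁻¹, a * c, b, c + b)`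
of `u * x + b = y`. -/
lemma card_pow_three_le_of_isUnit {M : Type*} [Ring M] [Fintype M] [DecidableEq M]
    (A : Finset M) (hA : ∀ a ∈ A, IsUnit a) (κ : ℝ) (hκ0 : 0 ≤ κ)
    (hκ : ∀ ψ : AddChar M ℂ, ψ ≠ 0 → (Nat.card {w : M // ∀ x, ψ (w * x) = 1} : ℝ) ≤ κ) :
    (#A : ℝ) ^ 3 ≤ #(A * A) * #(A + A) * #A ^ 2 / Fintype.card M +
      √(κ * Fintype.card M * #(A * A) * #(A + A) * #A ^ 2) := by
  have hU : #(A.image Ring.inverse) ≤ #A := card_image_le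
  have hinj : #(A ×ˢ A ×ˢ A) ≤
      #{p ∈ A.image Ring.inverse ×ˢ (A * A) ×ˢ A ×ˢ (A + A) |
        p.1 * p.2.1 + p.2.2.1 = p.2.2.2} := by
    refine card_le_card_of_injOn (fun t ↦ (Ring.inverse t.1, t.1 * t.2.1, t.2.2, t.2.1 + t.2.2))
      ?_ ?_
    · rintro ⟨a, c, b⟩ h
      simp only [coe_product, Set.mem_prod, mem_coe] at h
      obtain ⟨ha, hc, hb⟩ := h
      simp only [coe_filter, Set.mem_ofPred_eq, mem_product]
      exact ⟨⟨mem_image_of_mem _ ha, mul_mem_mul ha hc, hb, add_mem_add hc hb⟩,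
        by rw [Ring.inverse_mul_cancel_left _ _ (hA a ha)]⟩
    · rintro ⟨a, c, b⟩ h ⟨a', c', b'⟩ h' heq
      simp only [coe_product, Set.mem_prod, mem_coe] at h h'
      simp only [Prod.mk.injEq] at heq ⊢
      obtain ⟨h1, -, rfl, h4⟩ := heq
      refine ⟨?_, add_right_cancel h4, rfl⟩
      obtain ⟨u, rfl⟩ := hA a h.1
      obtain ⟨v, rfl⟩ := hA a' h'.1
      rw [Ring.inverse_unit, Ring.inverse_unit] at h1
      rw [inv_injective (Units.ext h1)]
  calc (#A : ℝ) ^ 3 = (#(A ×ˢ A ×ˢ A) : ℝ) := by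
        rw [card_product, card_product]
        push_cast
        ring
    _ ≤ _ := Nat.cast_le.2 hinj
    _ ≤ _ := card_mul_add_eq_le (A.image Ring.inverse) (A * A) A (A + A) κ hκ
    _ ≤ #A * #(A * A) * #A * #(A + A) / Fintype.card M +
          √(κ * Fintype.card M * #A * #(A * A) * #A * #(A + A)) := by gcongr
    _ = _ := by ring_nf

end Fourier

/-! ### Right ideals and singular matrices over a finite local ring -/

section Matrices

open IsLocalRing

/-- A proper right ideal `K` of `M_n(R)`, for `R` local with residue field `k`, has index at least
`|k| ^ n`: if the `i`-th column of `w` witnesses `w ∉ K`, then placing multiples of that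
column in the `n` columns independently produces `|k| ^ n` distinct cosets of `K`. -/
lemma card_residueField_pow_le_index {R : Type*} [CommRing R] [Finite R] [IsLocalRing R] {n : ℕ}
    (K : AddSubgroup (Matrix (Fin n) (Fin n) R)) (hK : ∀ w ∈ K, ∀ x, w * x ∈ K) (hK' : K ≠ ⊤) :
    Nat.card (ResidueField R) ^ n ≤ K.index := by
  obtain ⟨w, hw⟩ : ∃ w, w ∉ K := by
    by_contra! h
    exact hK' (eq_top_iff.2 fun x _ ↦ h x)
  obtain ⟨i, hi⟩ : ∃ i, w * Matrix.single i i 1 ∉ K := by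
    by_contra! h
    apply hw
    have h1 : w = ∑ i, w * Matrix.single i i (1 : R) := by
      rw [← Matrix.mul_sum, Matrix.sum_single_eq_diagonal, Matrix.diagonal_one, mul_one]
    rw [h1]
    exact K.sum_mem fun i _ ↦ h i
  let s : ResidueField R → R := Function.surjInv residue_surjective
  let D (d : Fin n → R) : Matrix (Fin n) (Fin n) R := Matrix.of fun a b ↦ if a = i then d b else 0
  have hD (d : Fin n → R) (j : Fin n) : D d * Matrix.single j i 1 = Matrix.single i i (d j) := by
    ext a b
    by_cases hb : b = i
    · subst hb
      by_cases ha : a = b <;> simp [D, ha, Ne.symm, eq_comm]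
    · simp [D, Ne.symm hb, hb]
  let f (c : Fin n → ResidueField R) : Matrix (Fin n) (Fin n) R ⧸ K :=
    QuotientAddGroup.mk (w * D fun j ↦ s (c j))
  have hf : Function.Injective f := by
    intro c c' h
    have h1 : w * D (fun j ↦ -s (c j) + s (c' j)) ∈ K := by
      have h2 := QuotientAddGroup.eq.1 h
      convert h2 using 1
      rw [← mul_neg, ← mul_add]
      congr 1
      ext a b
      by_cases ha : a = i <;> simp [D, ha]
    ext j
    have h2 := hK _ h1 (Matrix.single j i 1)
    rw [mul_assoc, hD] at h2
    have h3 : ¬ IsUnit (-s (c j) + s (c' j)) := by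
      rintro hu
      obtain ⟨y, hy⟩ := hu.exists_right_inv
      apply hi
      have h4 := hK _ h2 (Matrix.single i i y)
      rwa [mul_assoc, Matrix.single_mul_single_same, hy] at h4
    have h4 : residue R (-s (c j) + s (c' j)) = 0 := by
      rwa [residue_eq_zero_iff, mem_maximalIdeal, mem_nonunits_iff]
    have hs (c : ResidueField R) : residue R (s c) = c :=
      Function.surjInv_eq residue_surjective c
    rw [map_add, map_neg, hs, hs, neg_add_eq_zero] at h4
    exact h4
  calc Nat.card (ResidueField R) ^ n = Nat.card (Fin n → ResidueField R) := by
        rw [Nat.card_fun, Nat.card_eq_fintype_card (α := Fin n), Fintype.card_fin]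
    _ ≤ _ := Nat.card_le_card_of_injective f hf

/-- The `w` with `w * M ⊆ ker ψ` form a proper right ideal when `ψ` is nontrivial. -/
lemma card_addChar_mul_eq_one_le {R : Type*} [CommRing R] [Finite R] [IsLocalRing R] {n : ℕ}
    (ψ : AddChar (Matrix (Fin n) (Fin n) R) ℂ) (hψ : ψ ≠ 0) :
    (Nat.card {w : Matrix (Fin n) (Fin n) R // ∀ x, ψ (w * x) = 1} : ℝ) ≤
      Nat.card (Matrix (Fin n) (Fin n) R) / (Nat.card (ResidueField R) : ℝ) ^ n := by
  let K : AddSubgroup (Matrix (Fin n) (Fin n) R) :=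
    { carrier := {w | ∀ x, ψ (w * x) = 1}
      zero_mem' := by simp
      add_mem' := fun {a b} ha hb x ↦ by rw [add_mul, AddChar.map_add_eq_mul, ha, hb, one_mul]
      neg_mem' := fun {a} ha x ↦ by rw [neg_mul, ← mul_neg]; exact ha _ }
  have hK := card_residueField_pow_le_index K
    (fun w hw x y ↦ by rw [mul_assoc]; exact hw _) fun h ↦ hψ <| by
      ext x
      have hx : x ∈ K := h ▸ AddSubgroup.mem_top x
      simpa using hx 1
  have hq : 0 < (Nat.card (ResidueField R) : ℝ) ^ n := by
    have : Finite (ResidueField R) := Finite.of_surjective _ residue_surjective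
    have : 0 < Nat.card (ResidueField R) := Nat.card_pos
    positivity
  rw [le_div_iff₀ hq]
  have h := K.card_mul_index
  rw [← h]
  push_cast
  gcongr
  · exact le_rfl
  · exact_mod_cast hK

/-- The Weierstrass product inequality. -/
lemma one_sub_sum_le_prod_one_sub {ι : Type*} (s : Finset ι) (f : ι → ℝ)
    (h0 : ∀ i ∈ s, 0 ≤ f i) (h1 : ∀ i ∈ s, f i ≤ 1) :
    1 - ∑ i ∈ s, f i ≤ ∏ i ∈ s, (1 - f i) := by
  classical
  induction s using Finset.induction_on with
  | empty => simp
  | insert a s ha ih =>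
    rw [Finset.sum_insert ha, Finset.prod_insert ha]
    have h2 := ih (fun i hi ↦ h0 i (Finset.mem_insert_of_mem hi))
      fun i hi ↦ h1 i (Finset.mem_insert_of_mem hi)
    have h3 := h0 a (Finset.mem_insert_self _ _)
    have h4 := h1 a (Finset.mem_insert_self _ _)
    have h5 : 0 ≤ ∑ i ∈ s, f i :=
      Finset.sum_nonneg fun i hi ↦ h0 i (Finset.mem_insert_of_mem hi)
    nlinarith [mul_le_mul_of_nonneg_left h2 (sub_nonneg.2 h4), mul_nonneg h3 h5]

/-- At most a proportion `n / q` of the `n × n` matrices over the field with `q` elements is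
singular. -/
lemma ncard_not_isUnit_field_le (k : Type*) [Field k] [Finite k] (n : ℕ) :
    ({w : Matrix (Fin n) (Fin n) k | ¬ IsUnit w}.ncard : ℝ) ≤
      n / Nat.card k * Nat.card (Matrix (Fin n) (Fin n) k) := by
  have := Fintype.ofFinite k
  set q : ℝ := (Nat.card k : ℝ) with hq
  have hq1 : 1 < q := by
    rw [hq]; exact_mod_cast Finite.one_lt_card
  have hq0 : 0 < q := by linarith
  have hcard : (Nat.card (Matrix (Fin n) (Fin n) k) : ℝ) = ∏ i : Fin n, q ^ n := by
    rw [Matrix, Nat.card_fun, Nat.card_fun]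
    simp [hq]
  have hunits : ({w : Matrix (Fin n) (Fin n) k | IsUnit w}.ncard : ℝ) =
      ∏ i : Fin n, (q ^ n - q ^ (i : ℕ)) := by
    have h1 : {w : Matrix (Fin n) (Fin n) k | IsUnit w} =
        Set.range (fun u : GL (Fin n) k ↦ (u : Matrix (Fin n) (Fin n) k)) := by
      ext w; exact Iff.rfl
    have h2 := Matrix.card_GL_field (𝔽 := k) n
    rw [h1, ← Set.image_univ, Set.ncard_image_of_injective _ Units.val_injective,
      Set.ncard_univ, h2]
    push_cast
    refine Finset.prod_congr rfl fun i _ ↦ ?_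
    rw [Nat.cast_sub (Nat.pow_le_pow_right Fintype.card_pos i.2.le), hq,
      Nat.card_eq_fintype_card]
    push_cast
    rfl
  have hcompl : ({w : Matrix (Fin n) (Fin n) k | IsUnit w}.ncard : ℝ) +
      {w : Matrix (Fin n) (Fin n) k | ¬ IsUnit w}.ncard =
      Nat.card (Matrix (Fin n) (Fin n) k) := by
    exact_mod_cast Set.ncard_add_ncard_compl {w : Matrix (Fin n) (Fin n) k | IsUnit w}
  have hfac : ∏ i : Fin n, (q ^ n - q ^ (i : ℕ)) =
      (∏ i : Fin n, q ^ n) * ∏ i : Fin n, (1 - q ^ (i : ℕ) / q ^ n) := by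
    rw [← Finset.prod_mul_distrib]
    refine Finset.prod_congr rfl fun i _ ↦ ?_
    field_simp
  have hi (i : Fin n) : q ^ (i : ℕ) / q ^ n ≤ 1 / q := by
    rw [div_le_div_iff₀ (by positivity) hq0, one_mul, ← pow_succ]
    exact pow_le_pow_right₀ hq1.le i.2
  have hprod : 1 - n / q ≤ ∏ i : Fin n, (1 - q ^ (i : ℕ) / q ^ n) := by
    refine le_trans ?_ (one_sub_sum_le_prod_one_sub _ _ (fun i _ ↦ by positivity)
      fun i _ ↦ (hi i).trans ((div_le_one hq0).2 hq1.le))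
    have : ∑ i : Fin n, q ^ (i : ℕ) / q ^ n ≤ ∑ i : Fin n, 1 / q :=
      Finset.sum_le_sum fun i _ ↦ hi i
    rw [Finset.sum_const, Finset.card_univ, Fintype.card_fin, nsmul_eq_mul, mul_one_div] at this
    linarith
  have hP : 0 < ∏ i : Fin n, q ^ n := Finset.prod_pos fun _ _ ↦ by positivity
  rw [hunits, hfac] at hcompl
  rw [hcard] at hcompl ⊢
  nlinarith [mul_le_mul_of_nonneg_left hprod hP.le]

lemma AddMonoidHom.ncard_preimage_of_surjective {G H : Type*} [AddGroup G] [AddGroup H] [Finite G]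
    [Finite H] (f : G →+ H) (hf : Function.Surjective f) (S : Set H) :
    (f ⁻¹' S).ncard = S.ncard * Nat.card f.ker := by
  calc (f ⁻¹' S).ncard = Nat.card (Σ s : S, f ⁻¹' {(s : H)}) :=
        Nat.card_congr
          { toFun := fun g ↦ ⟨⟨f g, g.2⟩, ⟨g, rfl⟩⟩
            invFun := fun p ↦ ⟨p.2, by
              have h : f p.2 = p.1 := p.2.2
              rw [Set.mem_preimage, h]
              exact p.1.2⟩
            left_inv := fun g ↦ rfl
            right_inv := by
              rintro ⟨⟨h, hs⟩, ⟨g, hg⟩⟩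
              obtain rfl : f g = h := hg
              rfl }
    _ = Nat.card (S × f.ker) := Nat.card_congr <|
        (Equiv.sigmaCongrRight fun s : S ↦ f.fiberEquivKerOfSurjective hf s).trans
          (Equiv.sigmaEquivProd _ _)
    _ = _ := Nat.card_prod _ _

/-- A matrix over a finite local ring is invertible if and only if its reduction is, so the
proportion of singular matrices is the same as over the residue field. -/
lemma ncard_not_isUnit_le (R : Type*) [CommRing R] [Finite R] [IsLocalRing R] (n : ℕ) :
    ({w : Matrix (Fin n) (Fin n) R | ¬ IsUnit w}.ncard : ℝ) ≤
      n / Nat.card (ResidueField R) * Nat.card (Matrix (Fin n) (Fin n) R) := by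
  have hkf : Finite (ResidueField R) := Finite.of_surjective _ residue_surjective
  let φ := (residue R).mapMatrix (m := Fin n)
  have hφ : Function.Surjective φ := fun w ↦
    ⟨w.map (Function.surjInv residue_surjective), by
      ext a b
      simp [φ, Function.surjInv_eq]⟩
  have hu (w : Matrix (Fin n) (Fin n) R) : IsUnit (φ w) ↔ IsUnit w := by
    rw [Matrix.isUnit_iff_isUnit_det, Matrix.isUnit_iff_isUnit_det, ← RingHom.map_det,
      isUnit_map_iff]
  have hfib (S : Set (Matrix (Fin n) (Fin n) (ResidueField R))) :
      (φ ⁻¹' S).ncard = S.ncard * Nat.card φ.toAddMonoidHom.ker :=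
    φ.toAddMonoidHom.ncard_preimage_of_surjective hφ S
  have h1 : {w : Matrix (Fin n) (Fin n) R | ¬ IsUnit w} = φ ⁻¹' {w | ¬ IsUnit w} := by
    ext w; simp [hu]
  have h2 := hfib Set.univ
  rw [Set.preimage_univ, Set.ncard_univ, Set.ncard_univ] at h2
  rw [h1, hfib, h2]
  push_cast
  rw [← mul_assoc]
  gcongr
  exact ncard_not_isUnit_field_le _ n

end Matrices

/-! ### The sum-product estimate -/

section SumProduct

open IsLocalRing

/-- The bound on `|A * A| * |A + A|` for a set of units: whichever of the main term and the error
term dominates in the count gives one of the two alternatives. -/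
lemma min_le_ncard_mul_mul_ncard_add {R : Type*} [CommRing R] [Finite R] [IsLocalRing R] {n : ℕ}
    (A : Set (Matrix (Fin n) (Fin n) R)) (hA : ∀ a ∈ A, IsUnit a) (hA0 : A.Nonempty) :
    min ((A.ncard : ℝ) * Nat.card (Matrix (Fin n) (Fin n) R) / 2)
        ((A.ncard : ℝ) ^ 4 * (Nat.card (ResidueField R) : ℝ) ^ n /
          (4 * (Nat.card (Matrix (Fin n) (Fin n) R) : ℝ) ^ 2)) ≤
      ((A * A).ncard : ℝ) * (A + A).ncard := by
  classical
  have := Fintype.ofFinite (Matrix (Fin n) (Fin n) R)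
  have : Finite (ResidueField R) := Finite.of_surjective _ residue_surjective
  lift A to Finset (Matrix (Fin n) (Fin n) R) using Set.toFinite A
  rw [← Finset.coe_mul, ← Finset.coe_add]
  simp only [Set.ncard_coe_finset]
  have h := card_pow_three_le_of_isUnit A hA
    (Nat.card (Matrix (Fin n) (Fin n) R) / (Nat.card (ResidueField R) : ℝ) ^ n) (by positivity)
    fun ψ hψ ↦ card_addChar_mul_eq_one_le ψ hψ
  rw [← Nat.card_eq_fintype_card] at h
  have hm : 0 < (Nat.card (Matrix (Fin n) (Fin n) R) : ℝ) := Nat.cast_pos.2 Nat.card_pos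
  have hq : 0 < (Nat.card (ResidueField R) : ℝ) ^ n :=
    pow_pos (Nat.cast_pos.2 Nat.card_pos) n
  have ha : 0 < (A.card : ℝ) := by
    exact_mod_cast Finset.card_pos.2 (by simpa using hA0)
  generalize (Nat.card (Matrix (Fin n) (Fin n) R) : ℝ) = m at *
  generalize (Nat.card (ResidueField R) : ℝ) ^ n = t at *
  generalize (A.card : ℝ) = a at *
  have hP : 0 ≤ ((A * A).card : ℝ) * (A + A).card := by positivity
  rw [mul_assoc (m / t * m)] at h
  generalize ((A * A).card : ℝ) * (A + A).card = P at *
  rcases le_total (a ^ 3 / 2) (P * a ^ 2 / m) with h1 | h1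
  · refine (min_le_left _ _).trans ?_
    rw [div_le_div_iff₀ two_pos hm] at h1
    have : a ^ 2 * (a * m / 2) ≤ a ^ 2 * P := by linarith
    exact le_of_mul_le_mul_left this (by positivity)
  · refine (min_le_right _ _).trans ?_
    have h2 : a ^ 3 / 2 ≤ √(m / t * m * P * a ^ 2) := by linarith
    have h3 : (a ^ 3 / 2) ^ 2 ≤ m / t * m * P * a ^ 2 :=
      (Real.le_sqrt' (by positivity)).1 h2
    have h4 : (a ^ 3 / 2) ^ 2 * t ≤ m ^ 2 * P * a ^ 2 := by
      calc _ ≤ m / t * m * P * a ^ 2 * t := by gcongr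
        _ = _ := by field_simp
    rw [div_le_iff₀ (by positivity)]
    have : a ^ 2 * (a ^ 4 * t) ≤ a ^ 2 * (P * (4 * m ^ 2)) := by linarith
    exact le_of_mul_le_mul_left this (by positivity)

end SumProduct

/-- Sum-product estimate on matrices over a finite chain ring, i.e. a finite commutative local
principal ideal ring. The constant `C` depends only on `n`. `A + A` and `A * A` are the pointwise
sum set and product set, and exponents are real. -/
theorem mainTheorem2 (n : ℕ) (hn : 0 < n) :
    ∃ C : ℝ, 0 < C ∧
      ∀ (R : Type*) [CommRing R] [Finite R] [IsLocalRing R] [IsPrincipalIdealRing R]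
        (q r : ℕ), Nat.card (IsLocalRing.ResidueField R) = q → Nat.card R = q ^ r →
        ∀ A : Set (Matrix (Fin n) (Fin n) R),
          C * (q : ℝ) ^ ((r : ℝ) * (n : ℝ) ^ 2 - 1) ≤ (A.ncard : ℝ) →
          C⁻¹ * min
              ((A.ncard : ℝ) ^ 2 / (q : ℝ) ^ ((r : ℝ) * (n : ℝ) ^ 2 - ((n : ℝ) + 1) / 4))
              ((q : ℝ) ^ ((r : ℝ) * (n : ℝ) ^ 2 / 3) * (A.ncard : ℝ) ^ ((2 : ℝ) / 3))
            ≤ max ((A + A).ncard : ℝ) ((A * A).ncard : ℝ) := by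
  have hn1 : (1 : ℝ) ≤ n := by exact_mod_cast hn
  refine ⟨8 * n, by positivity, ?_⟩
  intro R _ _ _ _ q r hq hr A hA
  have : Finite (IsLocalRing.ResidueField R) :=
    Finite.of_surjective _ IsLocalRing.residue_surjective
  have hq1 : (1 : ℝ) < q := by
    rw [← hq]; exact_mod_cast Finite.one_lt_card
  have hq0 : (0 : ℝ) < q := by linarith
  have hm : (Nat.card (Matrix (Fin n) (Fin n) R) : ℝ) = (q : ℝ) ^ ((r : ℝ) * (n : ℝ) ^ 2) := by
    have h1 : Nat.card (Matrix (Fin n) (Fin n) R) = q ^ (r * n ^ 2) := by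
      rw [Matrix, Nat.card_fun, Nat.card_fun, hr, Nat.card_eq_fintype_card (α := Fin n),
        Fintype.card_fin, ← pow_mul, ← pow_mul]
      ring_nf
    rw [h1, Nat.cast_pow, ← Real.rpow_natCast, Nat.cast_mul, Nat.cast_pow]
  set m : ℝ := (q : ℝ) ^ ((r : ℝ) * (n : ℝ) ^ 2) with hm_def
  have hm0 : 0 < m := by positivity
  rw [Real.rpow_sub hq0, Real.rpow_one, ← hm_def] at hA
  have ha0 : (0 : ℝ) < A.ncard := lt_of_lt_of_le (by positivity) hA
  have ham : (A.ncard : ℝ) ≤ m := by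
    rw [← hm]; exact_mod_cast Set.ncard_le_card A
  -- At least half of the elements of `A` are invertible.
  let A' : Set (Matrix (Fin n) (Fin n) R) := {a ∈ A | IsUnit a}
  have hsub : A' ⊆ A := fun a ha ↦ ha.1
  have hA' : (A.ncard : ℝ) / 2 ≤ A'.ncard := by
    have h1 := ncard_not_isUnit_le R n
    rw [hq, hm] at h1
    have h2 : A.ncard ≤ A'.ncard + {w : Matrix (Fin n) (Fin n) R | ¬ IsUnit w}.ncard := by
      refine (Set.ncard_le_ncard ?_ (Set.toFinite _)).trans (Set.ncard_union_le _ _)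
      intro a ha
      by_cases hu : IsUnit a
      · exact .inl ⟨ha, hu⟩
      · exact .inr hu
    have h3 : (A.ncard : ℝ) ≤ A'.ncard + {w : Matrix (Fin n) (Fin n) R | ¬ IsUnit w}.ncard := by
      exact_mod_cast h2
    have h4 : 8 * (n / q * m) ≤ A.ncard := by
      calc _ = 8 * n * (m / q) := by ring
        _ ≤ _ := hA
    linarith
  have hA'0 : A'.Nonempty := by
    rw [← Set.ncard_pos, ← Nat.cast_pos (α := ℝ)]
    linarith
  have hmin := min_le_ncard_mul_mul_ncard_add A' (fun a ha ↦ ha.2) hA'0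
  rw [hm, hq] at hmin
  set X : ℝ := max ((A + A).ncard : ℝ) ((A * A).ncard : ℝ) with hX
  have hX0 : 0 ≤ X := le_max_of_le_left (Nat.cast_nonneg _)
  have hprod : ((A' * A').ncard : ℝ) * (A' + A').ncard ≤ X ^ 2 := by
    have h1 : ((A' * A').ncard : ℝ) ≤ X := le_max_of_le_right <| Nat.cast_le.2 <|
      Set.ncard_le_ncard (Set.mul_subset_mul hsub hsub) (Set.toFinite _)
    have h2 : ((A' + A').ncard : ℝ) ≤ X := le_max_of_le_left <| Nat.cast_le.2 <|
      Set.ncard_le_ncard (Set.add_subset_add hsub hsub) (Set.toFinite _)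
    rw [sq]
    gcongr
  replace hmin := hmin.trans hprod
  generalize (A.ncard : ℝ) = a at *
  generalize (A'.ncard : ℝ) = a' at *
  have hC : (8 * (n : ℝ))⁻¹ ≤ 1 / 8 := by
    rw [inv_eq_one_div]
    exact one_div_le_one_div_of_le (by norm_num) (by linarith)
  rcases min_le_iff.1 hmin with h | h
  · -- Since `a ≤ m`, the bound `√(m * a)` is stronger than `m ^ (1 / 3) * a ^ (2 / 3)`.
    have h1 : q ^ ((r : ℝ) * (n : ℝ) ^ 2 / 3) * a ^ ((2 : ℝ) / 3) ≤ √(m * a) := by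
      have h2 : (q : ℝ) ^ ((r : ℝ) * (n : ℝ) ^ 2 / 3) = m ^ ((1 : ℝ) / 3) := by
        rw [hm_def, ← Real.rpow_mul hq0.le]
        ring_nf
      have h3 : a ^ ((2 : ℝ) / 3) = a ^ ((1 : ℝ) / 6) * a ^ ((1 : ℝ) / 2) := by
        rw [← Real.rpow_add ha0]; norm_num
      have h4 : m ^ ((1 : ℝ) / 2) = m ^ ((1 : ℝ) / 3) * m ^ ((1 : ℝ) / 6) := by
        rw [← Real.rpow_add hm0]; norm_num
      rw [Real.sqrt_eq_rpow, Real.mul_rpow hm0.le ha0.le, h2, h3, h4, mul_assoc]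
      gcongr
    have h2 : √(m * a) / 8 ≤ X := by
      refine abs_le_of_sq_le_sq' ?_ hX0 |>.2
      rw [div_pow, Real.sq_sqrt (by positivity)]
      nlinarith
    calc _ ≤ 1 / 8 * √(m * a) :=
          mul_le_mul hC ((min_le_right _ _).trans h1) (by positivity) (by norm_num)
      _ ≤ X := by linarith
  · -- Since `(n + 1) / 4 ≤ n / 2`, the bound `a ^ 2 / (m / q ^ (n / 2))` is stronger than needed.
    set s : ℝ := (q : ℝ) ^ ((n : ℝ) / 2) with hs
    have hs0 : 0 < s := by positivity
    have hs2 : (q : ℝ) ^ n = s ^ 2 := by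
      rw [hs, ← Real.rpow_natCast, ← Real.rpow_natCast, ← Real.rpow_mul hq0.le]
      congr 1
      push_cast
      ring
    have h1 : a ^ 2 / (q : ℝ) ^ ((r : ℝ) * (n : ℝ) ^ 2 - ((n : ℝ) + 1) / 4) ≤ a ^ 2 * s / m := by
      rw [Real.rpow_sub hq0, ← hm_def, div_div_eq_mul_div]
      gcongr
      exact Real.rpow_le_rpow_of_exponent_le hq1.le (by linarith)
    have h2 : a ^ 2 * s / m / 8 ≤ X := by
      refine abs_le_of_sq_le_sq' ?_ hX0 |>.2
      refine le_trans ?_ h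
      rw [hs2]
      have h3 : (a / 2) ^ 4 ≤ a' ^ 4 := by gcongr
      calc (a ^ 2 * s / m / 8) ^ 2 = (a / 2) ^ 4 * s ^ 2 / (4 * m ^ 2) := by
            field_simp
            norm_num
        _ ≤ _ := by gcongr
    calc _ ≤ 1 / 8 * (a ^ 2 * s / m) :=
          mul_le_mul hC ((min_le_left _ _).trans h1) (by positivity) (by norm_num)
      _ ≤ X := by linarith
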